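/- Let $\underline\theta<0<\overline\theta$ and $\rho,v>0$. The return $\theta\in\Theta=[\underline\theta,\overline\theta]$ of a financial product has prior distribution $\mu_0$ with a continuous, strictly positive density $f$ on $[\underline\theta,\overline\theta]$ and cumulative distribution function $F$. Receiver chooses $a\in\{0,1\}$ ($a=1$: invest) and has utility $u(a,\theta)=a\theta$; Sender has utility $v(a)=va$. When the Bayesian posterior is $\mu\in\Delta\Theta$, Receiver (a wishful thinker) adopts a subjective belief $\eta\in\Delta\Theta$ that maximizes the psychological well-being $\max_{a}\int_\Theta u(a,\theta)\,\eta(\mathrm d\theta)-\frac1\rho D_{\mathrm{KL}}(\eta\,\|\,\mu)$, and then an action $a$ that maximizes $\int_\Theta u(a,\theta)\,\eta(\mathrm d\theta)$; all ties are broken in favor of Sender. Let $v(\mu)$ be Sender's resulting payoff at $\mu$. Sender chooses a signal structure; she thereby chooses a Bayes-plausible distribution $\tau$ over posteriors, that is, one with $\int\mu(B)\,\tau(\mathrm d\mu)=\mu_0(B)$ for every Borel set $B\subseteq\Theta$, and she maximizes $\int v(\mu)\,\tau(\mathrm d\mu)$ over all such $\tau$. Assume that $\int_\Theta e^{\rho\theta}\,\mu_0(\mathrm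 d\theta)<1$. Then there is a unique $\theta^W\in[\underline\theta,\overline\theta]$ with $F(\theta^W)<1$ and $$\frac{1}{1-F(\theta^W)}\int_{\theta^W}^{\overline\theta}e^{\rho\theta}f(\theta)\,\mathrm d\theta=1 .$$ The signal structure $\sigma$ that sends $s=1$ for sure in every state $\theta\ge\theta^W$ and $s=0$ for sure in every state $\theta<\theta^W$ is optimal for Sender, and $\theta^W$ is the only threshold in $[\underline\theta,\overline\theta]$ for which such a threshold signal is optimal. After $s=1$ Receiver invests and after $s=0$ he does not. Hence Sender induces investment with probability $\int_{\theta^W}^{\overline\theta}\sigma(1|\theta)f(\theta)\,\mathrm d\theta=1-F(\theta^W)$. -/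

import Mathlib

open MeasureTheory ProbabilityTheory

noncomputable section

namespace Wishful

variable {Θ : Type*} [MeasurableSpace Θ]

/-! ### Receiver: a wishful thinker with actions `0` and `1` -/

/-- The actions that are optimal under the subjective belief `η`, for the utility `u a θ`. -/
def optimalActions (u : Fin 2 → Θ → ℝ) (η : ProbabilityMeasure Θ) : Set (Fin 2) :=
  {a | ∀ b, ∫ θ, u b θ ∂(η : Measure Θ) ≤ ∫ θ, u a θ ∂(η : Measure Θ)}

/-- Anticipated utility under the subjective belief `η`: the expected utility of an optimal action,
that is, the largest expected utility over the two actions. -/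
def anticipatedUtility (u : Fin 2 → Θ → ℝ) (η : ProbabilityMeasure Θ) : ℝ :=
  ⨆ a, ∫ θ, u a θ ∂(η : Measure Θ)

/-- Psychological well-being of holding the belief `η` when the Bayesian belief is `μ`: anticipated
utility minus `1 / ρ` times the Kullback-Leibler divergence of `η` from `μ`. It is `-∞` when the
divergence is infinite. -/
def wellBeing (u : Fin 2 → Θ → ℝ) (ρ : ℝ) (η μ : ProbabilityMeasure Θ) : EReal :=
  ((anticipatedUtility u η : ℝ) : EReal) -
    ((1 / ρ : ℝ) : EReal) *
      ((InformationTheory.klDiv (η : Measure Θ) (μ : Measure Θ) : ENNReal) : EReal)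

/-- The subjective beliefs that maximize psychological well-being when the Bayesian belief
is `μ`. -/
def optimalBeliefs (u : Fin 2 → Θ → ℝ) (ρ : ℝ) (μ : ProbabilityMeasure Θ) :
    Set (ProbabilityMeasure Θ) :=
  {η | ∀ η', wellBeing u ρ η' μ ≤ wellBeing u ρ η μ}

/-- The actions that are optimal under some optimal subjective belief. -/
def rationalizedActions (u : Fin 2 → Θ → ℝ) (ρ : ℝ) (μ : ProbabilityMeasure Θ) : Set (Fin 2) :=
  {a | ∃ η ∈ optimalBeliefs u ρ μ, a ∈ optimalActions u η}

/-- The actions that may be played when the Bayesian belief is `μ`: Receiver breaks ties, both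
between optimal beliefs and between optimal actions, in favor of Sender, whose utility is `v`. -/
def equilibriumActions (u : Fin 2 → Θ → ℝ) (v : Fin 2 → ℝ) (ρ : ℝ) (μ : ProbabilityMeasure Θ) :
    Set (Fin 2) :=
  {a | a ∈ rationalizedActions u ρ μ ∧ ∀ b ∈ rationalizedActions u ρ μ, v b ≤ v a}

/-! ### Sender -/

/-- Sender's indirect utility at the Bayesian belief `μ`. -/
def indirectUtility (u : Fin 2 → Θ → ℝ) (v : Fin 2 → ℝ) (ρ : ℝ) (μ : ProbabilityMeasure Θ) : ℝ :=
  sSup (v '' rationalizedActions u ρ μ)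

/-- The information policies: Bayes-plausible distributions over posterior beliefs. -/
def bayesPlausible (μ₀ : ProbabilityMeasure Θ) : Set (Measure (ProbabilityMeasure Θ)) :=
  {τ | IsProbabilityMeasure τ ∧
    ∀ B : Set Θ, MeasurableSet B → ∫⁻ μ, (μ : Measure Θ) B ∂τ = (μ₀ : Measure Θ) B}

/-- Sender's expected payoff from the information policy `τ`. -/
def policyValue (u : Fin 2 → Θ → ℝ) (v : Fin 2 → ℝ) (ρ : ℝ)
    (τ : Measure (ProbabilityMeasure Θ)) : ℝ :=
  ∫ μ, indirectUtility u v ρ μ ∂τ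

/-- The policy `τ` solves Sender's information design problem with prior `μ₀`. -/
def IsOptimalPolicy (u : Fin 2 → Θ → ℝ) (v : Fin 2 → ℝ) (ρ : ℝ) (μ₀ : ProbabilityMeasure Θ)
    (τ : Measure (ProbabilityMeasure Θ)) : Prop :=
  τ ∈ bayesPlausible μ₀ ∧
    ∀ τ' ∈ bayesPlausible μ₀, policyValue u v ρ τ' ≤ policyValue u v ρ τ

section Signals

variable [StandardBorelSpace Θ] {S : Type*} [MeasurableSpace S]

/-- The Bayesian belief after the signal realization `s` of the signal structure `σ`. -/
def posteriorBelief (μ₀ : ProbabilityMeasure Θ) (σ : Kernel Θ S) [IsMarkovKernel σ] (s : S) :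
    ProbabilityMeasure Θ :=
  haveI : Nonempty Θ := nonempty_of_isProbabilityMeasure (μ₀ : Measure Θ)
  ⟨posterior σ (μ₀ : Measure Θ) s, inferInstance⟩

/-- The distribution over posterior beliefs that the signal structure `σ` induces. -/
def inducedPolicy (μ₀ : ProbabilityMeasure Θ) (σ : Kernel Θ S) [IsMarkovKernel σ] :
    Measure (ProbabilityMeasure Θ) :=
  ((μ₀ : Measure Θ).bind σ).map (posteriorBelief μ₀ σ)

end Signals

/-! ### The investor -/

/-- The investor's utility: the return `θ` if he invests (`a = 1`), and `0` otherwise. -/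
def investorUtility (θl θh : ℝ) (a : Fin 2) (θ : Set.Icc θl θh) : ℝ := ((a : ℕ) : ℝ) * (θ : ℝ)

/-- The broker's utility: the fee `v` if the investor invests (`a = 1`), and `0` otherwise. -/
def brokerUtility (v : ℝ) (a : Fin 2) : ℝ := v * ((a : ℕ) : ℝ)

/-- The binary signal that reveals whether the state is at least `t`: it sends `1` for sure in every
state `θ ≥ t`, and `0` for sure in every state `θ < t`. -/
def thresholdSignal (θl θh t : ℝ) : Kernel (Set.Icc θl θh) (Fin 2) :=
  Kernel.deterministic (fun θ => if t ≤ (θ : ℝ) then 1 else 0)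
    (Measurable.ite (measurableSet_le measurable_const measurable_subtype_coe)
      measurable_const measurable_const)

instance (θl θh t : ℝ) : IsMarkovKernel (thresholdSignal θl θh t) := by
  unfold thresholdSignal; infer_instance

instance (θl θh : ℝ) : StandardBorelSpace (Set.Icc θl θh) :=
  measurableSet_Icc.standardBorel

/-- The cumulative distribution function of the prior. -/
def priorCdf {θl θh : ℝ} (μ₀ : ProbabilityMeasure (Set.Icc θl θh)) (x : ℝ) : ℝ :=
  cdf ((μ₀ : Measure (Set.Icc θl θh)).map Subtype.val) x

end Wishful

end

/-! Write M(μ) = ∫ e^{ρθ} dμ. By the Donsker–Varadhan formula, the supremum over η of E_η[θ] −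
KL(η‖μ)/ρ is (1/ρ) log M(μ), attained at the exponential tilt of μ. Not investing yields at most 0,
attained at η = μ. With ties broken for Sender, Receiver therefore invests exactly when M(μ) ≥ 1
(`one_mem_rationalizedActions`, `zero_mem_rationalizedActions`), and Sender maximizes the τ-mass of
{M ≥ 1}.

The threshold is a zero of H(t) = ∫_t^{θh} (e^{ρx} − 1) f(x) dx. The hypothesis on the prior says
H(θl) < 0. H increases strictly on [θl, 0] and is positive on [0, θh), so it has exactly one zero
below θh, and this zero is negative (`exists_threshold`).

Optimality is a duality argument (`measureReal_one_le_expMoment_le`). The function g(θ) = 1 + c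
(e^{ρθ} − 1), with c > 0 chosen so that g(θW) = 0, satisfies 1{M(μ) ≥ 1} ≤ ∫ g⁺ dμ. The right side
is linear in μ, so under every Bayes-plausible τ it averages to ∫ g⁺ dμ₀. This equals μ₀(θ ≥ θW),
because g changes sign at θW and H(θW) = 0 removes the term in c. The threshold signal attains this
bound. A lower threshold never persuades, and a higher one persuades on a strictly smaller set of
states. -/

namespace Wishful

/-! ### Donsker–Varadhan -/

section Entropy

variable {α : Type*} [MeasurableSpace α]

/-- The Donsker–Varadhan inequality. -/
theorem integral_sub_toReal_klDiv_le {η μ : Measure α} [IsProbabilityMeasure η]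
    [IsProbabilityMeasure μ] {g : α → ℝ} (hη : Integrable g η)
    (hμ : Integrable (fun x => Real.exp (g x)) μ) (hkl : InformationTheory.klDiv η μ ≠ ⊤) :
    ∫ x, g x ∂η - (InformationTheory.klDiv η μ).toReal ≤ Real.log (∫ x, Real.exp (g x) ∂μ) := by
  obtain ⟨hac, hint⟩ := InformationTheory.klDiv_ne_top_iff.mp hkl
  rw [InformationTheory.toReal_klDiv_of_measure_eq hac (by simp)]
  have := isProbabilityMeasure_tilted hμ
  -- This is KL(η ‖ `μ.tilted g`) ≥ 0, which expands to KL(η‖μ) − ∫ g dη + log ∫ e^g dμ ≥ 0.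
  have h := InformationTheory.integral_llr_add_sub_measure_univ_nonneg
    (hac.trans (absolutelyContinuous_tilted hμ)) (integrable_llr_tilted_right hac hη hint hμ)
  rw [integral_llr_tilted_right hac hη hμ hint] at h
  simp only [probReal_univ] at h
  linarith

/-- The divergence of an exponentially tilted measure from the original one. -/
theorem klDiv_tilted_left {μ : Measure α} [IsProbabilityMeasure μ] {g : α → ℝ}
    (hμ : Integrable (fun x => Real.exp (g x)) μ) (hg : Integrable g (μ.tilted g)) :
    InformationTheory.klDiv (μ.tilted g) μ ≠ ⊤ ∧
      (InformationTheory.klDiv (μ.tilted g) μ).toReal =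
        ∫ x, g x ∂(μ.tilted g) - Real.log (∫ x, Real.exp (g x) ∂μ) := by
  have := isProbabilityMeasure_tilted hμ
  have hac := tilted_absolutelyContinuous μ g
  have h : llr (μ.tilted g) μ =ᵐ[μ.tilted g]
      fun x => g x - Real.log (∫ x, Real.exp (g x) ∂μ) :=
    hac.ae_le (log_rnDeriv_tilted_left_self hμ)
  refine ⟨InformationTheory.klDiv_ne_top hac ((integrable_congr h).mpr
    (hg.sub (integrable_const _))), ?_⟩
  rw [InformationTheory.toReal_klDiv_of_measure_eq hac (by simp), integral_congr_ae h,
    integral_sub hg (integrable_const _)]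
  simp

end Entropy

/-! ### Receiver's behavior -/

section Receiver

theorem wellBeing_of_klDiv_ne_top {Θ : Type*} [MeasurableSpace Θ] (u : Fin 2 → Θ → ℝ) (ρ : ℝ)
    {η μ : ProbabilityMeasure Θ}
    (h : InformationTheory.klDiv (η : Measure Θ) (μ : Measure Θ) ≠ ⊤) :
    wellBeing u ρ η μ = ((anticipatedUtility u η -
      1 / ρ * (InformationTheory.klDiv (η : Measure Θ) (μ : Measure Θ)).toReal : ℝ) : EReal) := by
  unfold wellBeing
  rw [EReal.coe_sub, EReal.coe_mul, EReal.coe_ennreal_toReal h]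

theorem wellBeing_of_klDiv_eq_top {Θ : Type*} [MeasurableSpace Θ] (u : Fin 2 → Θ → ℝ) {ρ : ℝ}
    (hρ : 0 < ρ) {η μ : ProbabilityMeasure Θ}
    (h : InformationTheory.klDiv (η : Measure Θ) (μ : Measure Θ) = ⊤) :
    wellBeing u ρ η μ = ⊥ := by
  unfold wellBeing
  rw [h, EReal.coe_ennreal_top, EReal.coe_mul_top_of_pos (by positivity), EReal.sub_top]

theorem wellBeing_self {Θ : Type*} [MeasurableSpace Θ] (u : Fin 2 → Θ → ℝ) (ρ : ℝ)
    (μ : ProbabilityMeasure Θ) : wellBeing u ρ μ μ = (anticipatedUtility u μ : EReal) := by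
  rw [wellBeing_of_klDiv_ne_top] <;> simp

variable {θl θh : ℝ}

/-- The moment generating function of the return, at the weight `ρ` of wishful thinking. -/
noncomputable def expMoment (ρ : ℝ) (μ : ProbabilityMeasure (Set.Icc θl θh)) : ℝ :=
  ∫ θ, Real.exp (ρ * (θ : ℝ)) ∂(μ : Measure (Set.Icc θl θh))

theorem integrable_of_continuous {μ : Measure (Set.Icc θl θh)} [IsFiniteMeasure μ]
    {g : Set.Icc θl θh → ℝ} (hg : Continuous g) : Integrable g μ :=
  hg.integrable_of_hasCompactSupport (HasCompactSupport.of_compactSpace g)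

theorem anticipatedUtility_investor (η : ProbabilityMeasure (Set.Icc θl θh)) :
    anticipatedUtility (investorUtility θl θh) η =
      max 0 (∫ θ, (θ : ℝ) ∂(η : Measure (Set.Icc θl θh))) := by
  unfold anticipatedUtility
  apply le_antisymm
  · refine ciSup_le fun a => ?_
    fin_cases a <;> simp [investorUtility]
  · refine max_le ?_ ?_
    · exact le_ciSup_of_le (Set.finite_range _).bddAbove 0 (by simp [investorUtility])
    · exact le_ciSup_of_le (Set.finite_range _).bddAbove 1 (by simp [investorUtility])

theorem zero_mem_optimalActions_investor (η : ProbabilityMeasure (Set.Icc θl θh)) :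
    0 ∈ optimalActions (investorUtility θl θh) η ↔
      ∫ θ, (θ : ℝ) ∂(η : Measure (Set.Icc θl θh)) ≤ 0 := by
  simp [optimalActions, investorUtility, Fin.forall_fin_two]

theorem one_mem_optimalActions_investor (η : ProbabilityMeasure (Set.Icc θl θh)) :
    1 ∈ optimalActions (investorUtility θl θh) η ↔
      0 ≤ ∫ θ, (θ : ℝ) ∂(η : Measure (Set.Icc θl θh)) := by
  simp [optimalActions, investorUtility, Fin.forall_fin_two]

theorem expMoment_pos (ρ : ℝ) (μ : ProbabilityMeasure (Set.Icc θl θh)) : 0 < expMoment ρ μ :=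
  integral_exp_pos (integrable_of_continuous (by fun_prop))

/-- Integrates 1 + x ≤ e^x. Consequently M(μ) ≤ 1 forces a nonpositive mean, so under the
undistorted belief not investing is optimal. -/
theorem one_add_mul_mean_le_expMoment (ρ : ℝ) (μ : ProbabilityMeasure (Set.Icc θl θh)) :
    1 + ρ * ∫ θ, (θ : ℝ) ∂(μ : Measure (Set.Icc θl θh)) ≤ expMoment ρ μ := by
  have h : ∫ θ : Set.Icc θl θh, (1 + ρ * (θ : ℝ)) ∂(μ : Measure (Set.Icc θl θh)) =
      1 + ρ * ∫ θ, (θ : ℝ) ∂(μ : Measure (Set.Icc θl θh)) := by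
    rw [integral_add (integrable_const _) (integrable_of_continuous (by fun_prop)),
      integral_const_mul]
    simp
  rw [← h]
  refine integral_mono (integrable_of_continuous (by fun_prop))
    (integrable_of_continuous (by fun_prop)) fun θ => ?_
  have := Real.add_one_le_exp (ρ * (θ : ℝ))
  dsimp only
  linarith

theorem mean_sub_klDiv_le {ρ : ℝ} (hρ : 0 < ρ) {η μ : ProbabilityMeasure (Set.Icc θl θh)}
    (hkl : InformationTheory.klDiv (η : Measure (Set.Icc θl θh)) μ ≠ ⊤) :
    ∫ θ, (θ : ℝ) ∂(η : Measure (Set.Icc θl θh)) -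
      1 / ρ * (InformationTheory.klDiv (η : Measure (Set.Icc θl θh)) μ).toReal ≤
        1 / ρ * Real.log (expMoment ρ μ) := by
  have h := integral_sub_toReal_klDiv_le (g := fun θ : Set.Icc θl θh => ρ * (θ : ℝ))
    (integrable_of_continuous (by fun_prop)) (integrable_of_continuous (by fun_prop)) hkl
  rw [integral_const_mul] at h
  have h' := mul_le_mul_of_nonneg_left h (one_div_pos.mpr hρ).le
  rw [mul_sub, ← mul_assoc, one_div_mul_cancel hρ.ne', one_mul] at h'
  exact h'

/-- The maximizer is μ tilted by ρθ, for which Donsker–Varadhan holds with equality. -/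
theorem exists_mean_sub_klDiv_eq {ρ : ℝ} (hρ : 0 < ρ) (μ : ProbabilityMeasure (Set.Icc θl θh)) :
    ∃ η : ProbabilityMeasure (Set.Icc θl θh),
      InformationTheory.klDiv (η : Measure (Set.Icc θl θh)) μ ≠ ⊤ ∧
      ∫ θ, (θ : ℝ) ∂(η : Measure (Set.Icc θl θh)) -
        1 / ρ * (InformationTheory.klDiv (η : Measure (Set.Icc θl θh)) μ).toReal =
          1 / ρ * Real.log (expMoment ρ μ) := by
  have hexp : Integrable (fun θ : Set.Icc θl θh => Real.exp (ρ * (θ : ℝ)))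
      (μ : Measure (Set.Icc θl θh)) := integrable_of_continuous (by fun_prop)
  have := isProbabilityMeasure_tilted hexp
  obtain ⟨h, h'⟩ := klDiv_tilted_left hexp (integrable_of_continuous (by fun_prop))
  refine ⟨⟨_, this⟩, h, ?_⟩
  rw [integral_const_mul] at h'
  simp only [ProbabilityMeasure.coe_mk]
  rw [h', expMoment]
  field_simp
  ring

/-- Anticipated utility is the larger of 0 and the mean. The first branch is bounded because the
divergence is nonnegative, the second by Donsker–Varadhan. -/
theorem wellBeing_investor_le {ρ : ℝ} (hρ : 0 < ρ) (η μ : ProbabilityMeasure (Set.Icc θl θh)) :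
    wellBeing (investorUtility θl θh) ρ η μ ≤
      ((max 0 (1 / ρ * Real.log (expMoment ρ μ)) : ℝ) : EReal) := by
  by_cases h : InformationTheory.klDiv (η : Measure (Set.Icc θl θh)) μ = ⊤
  · rw [wellBeing_of_klDiv_eq_top _ hρ h]
    exact bot_le
  · rw [wellBeing_of_klDiv_ne_top _ _ h, EReal.coe_le_coe_iff, anticipatedUtility_investor,
      sub_le_iff_le_add, max_le_iff]
    have h1 := mean_sub_klDiv_le hρ h
    have h2 := le_max_left 0 (1 / ρ * Real.log (expMoment ρ μ))
    have h3 := le_max_right 0 (1 / ρ * Real.log (expMoment ρ μ))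
    have h4 : 0 ≤ 1 / ρ *
      (InformationTheory.klDiv (η : Measure (Set.Icc θl θh)) μ).toReal := by positivity
    constructor <;> linarith

/-- Receiver may refrain from investing exactly if the exponential moment is at most one. -/
theorem zero_mem_rationalizedActions {ρ : ℝ} (hρ : 0 < ρ)
    (μ : ProbabilityMeasure (Set.Icc θl θh)) :
    0 ∈ rationalizedActions (investorUtility θl θh) ρ μ ↔ expMoment ρ μ ≤ 1 := by
  constructor
  · rintro ⟨η, hη, h0⟩
    rw [zero_mem_optimalActions_investor] at h0
    obtain ⟨η', hkl, heq⟩ := exists_mean_sub_klDiv_eq hρ μ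
    have h1 := hη η'
    rw [wellBeing_of_klDiv_ne_top _ _ hkl, anticipatedUtility_investor] at h1
    by_contra! hM
    -- The tilt has positive well-being, whereas a belief with nonpositive mean has well-being at
    -- most 0, so it cannot be optimal.
    have hlog : 0 < 1 / ρ * Real.log (expMoment ρ μ) := mul_pos (by positivity) (Real.log_pos hM)
    have h2 : wellBeing (investorUtility θl θh) ρ η μ ≤ ((0 : ℝ) : EReal) := by
      by_cases h : InformationTheory.klDiv (η : Measure (Set.Icc θl θh)) μ = ⊤
      · rw [wellBeing_of_klDiv_eq_top _ hρ h]
        exact bot_le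
      · rw [wellBeing_of_klDiv_ne_top _ _ h, EReal.coe_le_coe_iff, anticipatedUtility_investor,
          max_eq_left h0, zero_sub, neg_nonpos]
        positivity
    have h3 := EReal.coe_le_coe_iff.mp (h1.trans h2)
    have h4 := le_max_right 0 (∫ θ, (θ : ℝ) ∂(η' : Measure (Set.Icc θl θh)))
    linarith
  · intro hM
    have hmean : ∫ θ, (θ : ℝ) ∂(μ : Measure (Set.Icc θl θh)) ≤ 0 := by
      have := one_add_mul_mean_le_expMoment ρ μ
      by_contra! h
      have := mul_pos hρ h
      linarith
    refine ⟨μ, fun η => (wellBeing_investor_le hρ η μ).trans ?_,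
      (zero_mem_optimalActions_investor μ).mpr hmean⟩
    rw [wellBeing_self, anticipatedUtility_investor, EReal.coe_le_coe_iff, max_eq_left hmean]
    exact max_le le_rfl (mul_nonpos_of_nonneg_of_nonpos (by positivity)
      (Real.log_nonpos (expMoment_pos ρ μ).le hM))

/-- Receiver may invest exactly if the exponential moment is at least one. -/
theorem one_mem_rationalizedActions {ρ : ℝ} (hρ : 0 < ρ)
    (μ : ProbabilityMeasure (Set.Icc θl θh)) :
    1 ∈ rationalizedActions (investorUtility θl θh) ρ μ ↔ 1 ≤ expMoment ρ μ := by
  constructor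
  · rintro ⟨η, hη, h1⟩
    rw [one_mem_optimalActions_investor] at h1
    have h2 := hη μ
    rw [wellBeing_self, anticipatedUtility_investor] at h2
    -- Keeping η = μ guarantees well-being at least 0, but a belief that supports investing gets at
    -- most (1/ρ) log M(μ) < 0.
    by_contra! hM
    have hlog : 1 / ρ * Real.log (expMoment ρ μ) < 0 :=
      mul_neg_of_pos_of_neg (by positivity) (Real.log_neg (expMoment_pos ρ μ) hM)
    by_cases h : InformationTheory.klDiv (η : Measure (Set.Icc θl θh)) μ = ⊤
    · rw [wellBeing_of_klDiv_eq_top _ hρ h, le_bot_iff] at h2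
      exact EReal.coe_ne_bot _ h2
    · rw [wellBeing_of_klDiv_ne_top _ _ h, EReal.coe_le_coe_iff,
        anticipatedUtility_investor, max_eq_right h1] at h2
      have h3 := mean_sub_klDiv_le hρ h
      have h4 := le_max_left 0 (∫ θ, (θ : ℝ) ∂(μ : Measure (Set.Icc θl θh)))
      linarith
  · intro hM
    obtain ⟨η, hkl, heq⟩ := exists_mean_sub_klDiv_eq hρ μ
    have hlog : 0 ≤ 1 / ρ * Real.log (expMoment ρ μ) :=
      mul_nonneg (by positivity) (Real.log_nonneg hM)
    have hnn : 0 ≤ 1 / ρ *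
      (InformationTheory.klDiv (η : Measure (Set.Icc θl θh)) μ).toReal := by positivity
    have hmean : 0 ≤ ∫ θ, (θ : ℝ) ∂(η : Measure (Set.Icc θl θh)) := by linarith
    refine ⟨η, fun η' => (wellBeing_investor_le hρ η' μ).trans ?_,
      (one_mem_optimalActions_investor η).mpr hmean⟩
    rw [wellBeing_of_klDiv_ne_top _ _ hkl, anticipatedUtility_investor, max_eq_right hmean, heq,
      max_eq_right hlog]

theorem equilibriumActions_of_one_le {ρ v : ℝ} (hρ : 0 < ρ) (hv : 0 < v)
    {μ : ProbabilityMeasure (Set.Icc θl θh)} (h : 1 ≤ expMoment ρ μ) :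
    equilibriumActions (investorUtility θl θh) (brokerUtility v) ρ μ = {1} := by
  have h1 := (one_mem_rationalizedActions hρ μ).mpr h
  ext a
  simp only [equilibriumActions, Set.mem_ofPred_eq, Set.mem_singleton_iff]
  constructor
  · rintro ⟨-, ha⟩
    have := ha 1 h1
    fin_cases a
    · simp [brokerUtility] at this
      linarith
    · rfl
  · rintro rfl
    refine ⟨h1, fun b _ => ?_⟩
    fin_cases b <;> simp [brokerUtility, hv.le]

theorem equilibriumActions_of_lt_one {ρ v : ℝ} (hρ : 0 < ρ)
    {μ : ProbabilityMeasure (Set.Icc θl θh)} (h : expMoment ρ μ < 1) :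
    equilibriumActions (investorUtility θl θh) (brokerUtility v) ρ μ = {0} := by
  have h0 := (zero_mem_rationalizedActions hρ μ).mpr h.le
  have h1 : 1 ∉ rationalizedActions (investorUtility θl θh) ρ μ := by
    rw [one_mem_rationalizedActions hρ]
    exact not_le.mpr h
  ext a
  simp only [equilibriumActions, Set.mem_ofPred_eq, Set.mem_singleton_iff]
  constructor
  · rintro ⟨ha, -⟩
    fin_cases a
    · rfl
    · exact absurd ha h1
  · rintro rfl
    refine ⟨h0, fun b hb => ?_⟩
    fin_cases b
    · exact le_rfl
    · exact absurd hb h1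

theorem equilibriumActions_eq_singleton_one_iff {ρ v : ℝ} (hρ : 0 < ρ) (hv : 0 < v)
    (μ : ProbabilityMeasure (Set.Icc θl θh)) :
    equilibriumActions (investorUtility θl θh) (brokerUtility v) ρ μ = {1} ↔
      1 ≤ expMoment ρ μ := by
  refine ⟨fun h => ?_, equilibriumActions_of_one_le hρ hv⟩
  by_contra! hlt
  rw [equilibriumActions_of_lt_one hρ hlt] at h
  simp at h

/-- At M(μ) = 1 both actions are rationalized. The supremum then selects v, which is why the
inequality in the set is weak. -/
theorem indirectUtility_investor {ρ v : ℝ} (hρ : 0 < ρ) (hv : 0 < v)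
    (μ : ProbabilityMeasure (Set.Icc θl θh)) :
    indirectUtility (investorUtility θl θh) (brokerUtility v) ρ μ =
      {μ | 1 ≤ expMoment ρ μ}.indicator (fun _ => v) μ := by
  unfold indirectUtility
  by_cases h : 1 ≤ expMoment ρ μ
  · rw [Set.indicator_of_mem (by exact h)]
    refine IsGreatest.csSup_eq ⟨⟨1, (one_mem_rationalizedActions hρ μ).mpr h, ?_⟩, ?_⟩
    · simp [brokerUtility]
    · rintro _ ⟨b, -, rfl⟩
      fin_cases b <;> simp [brokerUtility, hv.le]
  · rw [Set.indicator_of_notMem (by exact h)]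
    have h0 := (zero_mem_rationalizedActions hρ μ).mpr (not_le.mp h).le
    refine IsGreatest.csSup_eq ⟨⟨0, h0, ?_⟩, ?_⟩
    · simp [brokerUtility]
    · rintro _ ⟨b, hb, rfl⟩
      fin_cases b
      · simp [brokerUtility]
      · exact absurd ((one_mem_rationalizedActions hρ μ).mp hb) h

end Receiver

end Wishful

namespace Wishful

/-! ### Sender's problem -/

section Sender

variable {θl θh : ℝ}

theorem measurable_toMeasure {Θ : Type*} [MeasurableSpace Θ] :
    Measurable (ProbabilityMeasure.toMeasure : ProbabilityMeasure Θ → Measure Θ) :=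
  measurable_subtype_coe

theorem measurable_expMoment (ρ : ℝ) :
    Measurable (expMoment ρ : ProbabilityMeasure (Set.Icc θl θh) → ℝ) := by
  have h : (expMoment ρ : ProbabilityMeasure (Set.Icc θl θh) → ℝ) = fun μ : ProbabilityMeasure (Set.Icc θl θh) =>
      (∫⁻ θ, ENNReal.ofReal (Real.exp (ρ * (θ : ℝ))) ∂(μ : Measure (Set.Icc θl θh))).toReal := by
    ext μ
    exact integral_eq_lintegral_of_nonneg_ae (ae_of_all _ fun _ => (Real.exp_pos _).le)
      (Continuous.aestronglyMeasurable (by fun_prop))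
  rw [h]
  exact ((Measure.measurable_lintegral (by fun_prop)).comp measurable_toMeasure).ennreal_toReal

theorem measurableSet_one_le_expMoment (ρ : ℝ) :
    MeasurableSet {μ : ProbabilityMeasure (Set.Icc θl θh) | 1 ≤ expMoment ρ μ} :=
  measurableSet_le measurable_const (measurable_expMoment ρ)

theorem policyValue_investor {ρ v : ℝ} (hρ : 0 < ρ) (hv : 0 < v)
    (τ : Measure (ProbabilityMeasure (Set.Icc θl θh))) :
    policyValue (investorUtility θl θh) (brokerUtility v) ρ τ =
      τ.real {μ | 1 ≤ expMoment ρ μ} * v := by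
  unfold policyValue
  simp_rw [indirectUtility_investor hρ hv]
  rw [integral_indicator (measurableSet_one_le_expMoment ρ)]
  simp

/-- Integrating a function against a Bayes-plausible distribution over posteriors. -/
theorem lintegral_lintegral_of_mem_bayesPlausible {Θ : Type*} [MeasurableSpace Θ]
    {μ₀ : ProbabilityMeasure Θ} {τ : Measure (ProbabilityMeasure Θ)} (hτ : τ ∈ bayesPlausible μ₀)
    {g : Θ → ENNReal} (hg : Measurable g) :
    ∫⁻ μ, ∫⁻ θ, g θ ∂(μ : Measure Θ) ∂τ = ∫⁻ θ, g θ ∂(μ₀ : Measure Θ) := by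
  -- Bayes plausibility says that the barycenter of τ, its `join` in the Giry monad, is the prior.
  have h : (τ.map ((↑) : ProbabilityMeasure Θ → Measure Θ)).join = μ₀ := by
    ext B hB
    rw [Measure.join_apply hB, lintegral_map (Measure.measurable_coe hB) measurable_toMeasure,
      hτ.2 B hB]
  rw [← h, Measure.lintegral_join hg.aemeasurable,
    lintegral_map (Measure.measurable_lintegral hg) measurable_toMeasure]

/-- The probability of investment under any information policy is at most the prior probability of
the states above a threshold at which the wishful investor is indifferent. -/
theorem measureReal_one_le_expMoment_le {ρ t : ℝ} (hρ : 0 < ρ) (ht : t < 0)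
    {μ₀ : ProbabilityMeasure (Set.Icc θl θh)}
    (hind : ∫ θ in {θ : Set.Icc θl θh | t ≤ (θ : ℝ)}, (Real.exp (ρ * (θ : ℝ)) - 1)
      ∂(μ₀ : Measure (Set.Icc θl θh)) = 0)
    {τ : Measure (ProbabilityMeasure (Set.Icc θl θh))} (hτ : τ ∈ bayesPlausible μ₀) :
    τ.real {μ | 1 ≤ expMoment ρ μ} ≤
      (μ₀ : Measure (Set.Icc θl θh)).real {θ | t ≤ (θ : ℝ)} := by
  have hexp : Real.exp (ρ * t) < 1 := Real.exp_lt_one_iff.mpr (mul_neg_of_pos_of_neg hρ ht)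
  have hpos : 0 < 1 - Real.exp (ρ * t) := sub_pos.mpr hexp
  -- The multiplier that makes g below vanish at t; it is positive because t < 0.
  set c : ℝ := (1 - Real.exp (ρ * t))⁻¹
  have hcpos : 0 < c := inv_pos.mpr hpos
  have hct : c * (1 - Real.exp (ρ * t)) = 1 := inv_mul_cancel₀ hpos.ne'
  let g : Set.Icc θl θh → ℝ := fun θ => 1 + c * (Real.exp (ρ * (θ : ℝ)) - 1)
  have hg : Continuous g := by fun_prop
  have hg_nonneg : ∀ θ : Set.Icc θl θh, t ≤ (θ : ℝ) → 0 ≤ g θ := fun θ hθ => by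
    have h := Real.exp_le_exp.mpr (mul_le_mul_of_nonneg_left hθ hρ.le)
    have := mul_le_mul_of_nonneg_left h hcpos.le
    simp only [g]
    linarith
  have hg_nonpos : ∀ θ : Set.Icc θl θh, (θ : ℝ) < t → g θ ≤ 0 := fun θ hθ => by
    have h := Real.exp_le_exp.mpr (mul_le_mul_of_nonneg_left hθ.le hρ.le)
    have := mul_le_mul_of_nonneg_left h hcpos.le
    simp only [g]
    linarith
  have hgint : ∀ μ : ProbabilityMeasure (Set.Icc θl θh),
      ∫ θ, g θ ∂(μ : Measure (Set.Icc θl θh)) = 1 + c * (expMoment ρ μ - 1) := fun μ => by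
    rw [integral_add (integrable_const _) (integrable_of_continuous (by fun_prop)),
      integral_const_mul, integral_sub (integrable_of_continuous (by fun_prop))
        (integrable_const _)]
    simp [expMoment]
  have hE : MeasurableSet {θ : Set.Icc θl θh | t ≤ (θ : ℝ)} :=
    measurableSet_le measurable_const measurable_subtype_coe
  -- `ENNReal.ofReal` truncates g to g⁺. Where M(μ) ≥ 1, ∫ g⁺ dμ ≥ ∫ g dμ = 1 + c (M(μ) − 1) ≥ 1;
  -- elsewhere 0 is a lower bound.
  have h1 : τ {μ | 1 ≤ expMoment ρ μ} ≤
      ∫⁻ μ, ∫⁻ θ, ENNReal.ofReal (g θ) ∂(μ : Measure (Set.Icc θl θh)) ∂τ := by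
    rw [← lintegral_indicator_one (measurableSet_one_le_expMoment ρ)]
    refine lintegral_mono fun μ => ?_
    by_cases h : 1 ≤ expMoment ρ μ
    · rw [Set.indicator_of_mem (by exact h), Pi.one_apply]
      calc (1 : ENNReal) ≤ ENNReal.ofReal (∫ θ, g θ ∂(μ : Measure (Set.Icc θl θh))) := by
            rw [ENNReal.one_le_ofReal, hgint]
            have := mul_nonneg hcpos.le (sub_nonneg.mpr h)
            linarith
        _ ≤ ENNReal.ofReal (∫ θ, max (g θ) 0 ∂(μ : Measure (Set.Icc θl θh))) :=
            ENNReal.ofReal_le_ofReal (integral_mono (integrable_of_continuous hg)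
              (integrable_of_continuous (by fun_prop)) fun θ => le_max_left _ _)
        _ = ∫⁻ θ, ENNReal.ofReal (g θ) ∂(μ : Measure (Set.Icc θl θh)) := by
            rw [ofReal_integral_eq_lintegral_ofReal (integrable_of_continuous (by fun_prop))
              (ae_of_all _ fun θ => le_max_right (g θ) 0)]
            simp
    · rw [Set.indicator_of_notMem (by exact h)]
      exact zero_le
  -- As g increases through 0 at t, g⁺ is g on {θ ≥ t} and 0 below; `hind` then cancels the part
  -- multiplied by c.
  have h2 : ∫⁻ θ, ENNReal.ofReal (g θ) ∂(μ₀ : Measure (Set.Icc θl θh)) =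
      ENNReal.ofReal ((μ₀ : Measure (Set.Icc θl θh)).real {θ | t ≤ (θ : ℝ)}) := by
    have h3 : (fun θ => ENNReal.ofReal (g θ)) =
        {θ : Set.Icc θl θh | t ≤ (θ : ℝ)}.indicator (fun θ => ENNReal.ofReal (g θ)) := by
      ext θ
      by_cases h : t ≤ (θ : ℝ)
      · rw [Set.indicator_of_mem (by exact h)]
      · rw [Set.indicator_of_notMem (by exact h), ENNReal.ofReal_of_nonpos
          (hg_nonpos θ (not_le.mp h))]
    rw [h3, lintegral_indicator hE, ← ofReal_integral_eq_lintegral_ofReal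
      (integrable_of_continuous hg)
      ((ae_restrict_iff' hE).mpr (ae_of_all _ fun θ hθ => hg_nonneg θ hθ)),
      integral_add (integrable_const _) (integrable_of_continuous (by fun_prop)),
      integral_const_mul, hind]
    simp
  rw [lintegral_lintegral_of_mem_bayesPlausible hτ (by fun_prop), h2] at h1
  exact ENNReal.toReal_le_of_le_ofReal measureReal_nonneg h1

end Sender

/-! ### Deterministic signals -/

section Signals

variable {Θ : Type*} [MeasurableSpace Θ] [StandardBorelSpace Θ] {S : Type*} [MeasurableSpace S]

theorem inducedPolicy_mem_bayesPlausible (μ₀ : ProbabilityMeasure Θ) (σ : Kernel Θ S)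
    [IsMarkovKernel σ] : inducedPolicy μ₀ σ ∈ bayesPlausible μ₀ := by
  have : Nonempty Θ := nonempty_of_isProbabilityMeasure (μ₀ : Measure Θ)
  have hm : Measurable (posteriorBelief μ₀ σ) :=
    Measurable.subtype_mk (posterior σ (μ₀ : Measure Θ)).measurable
  refine ⟨Measure.isProbabilityMeasure_map hm.aemeasurable, fun B hB => ?_⟩
  unfold inducedPolicy
  refine (lintegral_map ((Measure.measurable_coe hB).comp measurable_toMeasure) hm).trans ?_
  -- Averaging the posteriors over the law of the signal returns the prior.
  conv_rhs => rw [← posterior_comp_self (κ := σ) (μ := (μ₀ : Measure Θ)),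
    Measure.bind_apply hB (Kernel.aemeasurable _)]
  rfl

/-- Bayes' rule for a signal that reveals a function of the state. -/
theorem smul_posteriorBelief_deterministic [MeasurableSingletonClass S]
    (μ₀ : ProbabilityMeasure Θ) {T : Θ → S} (hT : Measurable T) (s : S) :
    (μ₀ : Measure Θ) (T ⁻¹' {s}) •
      (posteriorBelief μ₀ (Kernel.deterministic T hT) s : Measure Θ) =
        (μ₀ : Measure Θ).restrict (T ⁻¹' {s}) := by
  have : Nonempty Θ := nonempty_of_isProbabilityMeasure (μ₀ : Measure Θ)
  ext B hB
  -- The two disintegrations of the joint law of signal and state are compared on {s} × B.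
  have h := congrArg (fun m => m ({s} ×ˢ B)) (compProd_posterior_eq_map_swap
    (κ := Kernel.deterministic T hT) (μ := (μ₀ : Measure Θ)))
  have hs : MeasurableSet ({s} : Set S) := measurableSet_singleton s
  rw [Measure.compProd_apply_prod hs hB, Measure.map_apply measurable_swap (hs.prod hB),
    Set.preimage_swap_prod, Measure.compProd_apply_prod hB hs,
    Measure.deterministic_comp_eq_map, lintegral_singleton, Measure.map_apply hT hs] at h
  rw [Measure.smul_apply, Measure.restrict_apply hB, smul_eq_mul, mul_comm]
  refine h.trans ?_
  simp_rw [Kernel.deterministic_apply' hT _ hs]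
  rw [← lintegral_indicator hB, Set.inter_comm, ← lintegral_indicator_one ((hT hs).inter hB)]
  congr with θ
  by_cases h1 : θ ∈ B <;> by_cases h2 : T θ = s <;> simp [h1, h2, Set.indicator]

/-- The product form avoids dividing by the probability of s. For a null signal both sides vanish
and the posterior is unconstrained. -/
theorem measureReal_mul_integral_posteriorBelief_deterministic [MeasurableSingletonClass S]
    (μ₀ : ProbabilityMeasure Θ) {T : Θ → S} (hT : Measurable T) (s : S) (g : Θ → ℝ) :
    (μ₀ : Measure Θ).real (T ⁻¹' {s}) *
      ∫ θ, g θ ∂(posteriorBelief μ₀ (Kernel.deterministic T hT) s : Measure Θ) =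
        ∫ θ in T ⁻¹' {s}, g θ ∂(μ₀ : Measure Θ) := by
  rw [← smul_posteriorBelief_deterministic μ₀ hT s, integral_smul_measure, smul_eq_mul]
  rfl

theorem inducedPolicy_deterministic (μ₀ : ProbabilityMeasure Θ) {T : Θ → S} (hT : Measurable T)
    {A : Set (ProbabilityMeasure Θ)} (hA : MeasurableSet A) :
    inducedPolicy μ₀ (Kernel.deterministic T hT) A =
      (μ₀ : Measure Θ) {θ | posteriorBelief μ₀ (Kernel.deterministic T hT) (T θ) ∈ A} := by
  have : Nonempty Θ := nonempty_of_isProbabilityMeasure (μ₀ : Measure Θ)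
  have hm : Measurable (posteriorBelief μ₀ (Kernel.deterministic T hT)) :=
    Measurable.subtype_mk (posterior (Kernel.deterministic T hT) (μ₀ : Measure Θ)).measurable
  unfold inducedPolicy
  rw [Measure.map_apply hm hA, Measure.deterministic_comp_eq_map, Measure.map_apply hT (hm hA)]
  rfl

end Signals

end Wishful

namespace Wishful

/-! ### The indifference threshold -/

section Threshold

/-- The integrand has the sign of x, so raising t towards 0 discards negative mass, and for t in [0,
θh) only positive mass is left. The last clause serves the posterior after signal 0, whose excess
moment is proportional to H(θl) − H(t). -/
theorem exists_threshold {θl θh ρ : ℝ} (hl : θl < 0) (hh : 0 < θh) (hρ : 0 < ρ)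
    {f : ℝ → ℝ} (hf : ContinuousOn f (Set.Icc θl θh)) (hfpos : ∀ θ ∈ Set.Icc θl θh, 0 < f θ)
    (hneg : ∫ x in θl..θh, (Real.exp (ρ * x) - 1) * f x < 0) :
    ∃ θW ∈ Set.Ioo θl 0, ∫ x in θW..θh, (Real.exp (ρ * x) - 1) * f x = 0 ∧
      (∀ t ∈ Set.Ico θl θW, ∫ x in t..θh, (Real.exp (ρ * x) - 1) * f x < 0) ∧
      (∀ t ∈ Set.Ioo θW θh, 0 < ∫ x in t..θh, (Real.exp (ρ * x) - 1) * f x) ∧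
      ∀ t ∈ Set.Ioc θl θh, ∫ x in θl..θh, (Real.exp (ρ * x) - 1) * f x <
        ∫ x in t..θh, (Real.exp (ρ * x) - 1) * f x := by
  set k : ℝ → ℝ := fun x => (Real.exp (ρ * x) - 1) * f x
  have hlh : θl ≤ θh := (hl.trans hh).le
  have hcont : ContinuousOn k (Set.Icc θl θh) := ContinuousOn.mul (by fun_prop) hf
  have hint : ∀ a ∈ Set.Icc θl θh, ∀ b ∈ Set.Icc θl θh, IntervalIntegrable k volume a b :=
    fun a ha b hb => (hcont.mono (Set.uIcc_subset_Icc ha hb)).intervalIntegrable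
  have hhmem : θh ∈ Set.Icc θl θh := Set.right_mem_Icc.mpr hlh
  have hsplit : ∀ a ∈ Set.Icc θl θh, ∀ b ∈ Set.Icc θl θh,
      ∫ x in a..θh, k x = (∫ x in a..b, k x) + ∫ x in b..θh, k x := fun a ha b hb =>
    (intervalIntegral.integral_add_adjacent_intervals (hint a ha b hb)
      (hint b hb θh hhmem)).symm
  have hinc : ∀ a b, θl ≤ a → a < b → b ≤ 0 → ∫ x in a..θh, k x < ∫ x in b..θh, k x := by
    intro a b ha hab hb
    have ha' : a ∈ Set.Icc θl θh := ⟨ha, by linarith⟩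
    have hb' : b ∈ Set.Icc θl θh := ⟨by linarith, by linarith⟩
    have h := intervalIntegral.intervalIntegral_pos_of_pos_on (hint a ha' b hb').neg
      (fun x hx => by
        have h1 : Real.exp (ρ * x) < 1 :=
          Real.exp_lt_one_iff.mpr (mul_neg_of_pos_of_neg hρ (hx.2.trans_le hb))
        have h2 := hfpos x ⟨ha'.1.trans hx.1.le, hx.2.le.trans hb'.2⟩
        exact neg_pos.mpr (mul_neg_of_neg_of_pos (sub_neg.mpr h1) h2)) hab
    simp only [Pi.neg_apply, intervalIntegral.integral_neg] at h
    rw [hsplit a ha' b hb']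
    linarith
  have hpos : ∀ a, 0 ≤ a → a < θh → 0 < ∫ x in a..θh, k x := by
    intro a ha hab
    have ha' : a ∈ Set.Icc θl θh := ⟨by linarith, hab.le⟩
    refine intervalIntegral.intervalIntegral_pos_of_pos_on (hint a ha' θh hhmem)
      (fun x hx => ?_) hab
    have h1 : 1 < Real.exp (ρ * x) := Real.one_lt_exp_iff.mpr (mul_pos hρ (ha.trans_lt hx.1))
    exact mul_pos (sub_pos.mpr h1) (hfpos x ⟨ha'.1.trans hx.1.le, hx.2.le⟩)
  have hHcont : ContinuousOn (fun t => ∫ x in t..θh, k x) (Set.Icc θl 0) := by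
    have h := intervalIntegral.continuousOn_primitive_interval_left
      (μ := volume) (f := k) (a := θl) (b := θh) (by
        rw [Set.uIcc_of_le hlh]
        exact hcont.integrableOn_Icc)
    rw [Set.uIcc_of_le hlh] at h
    exact h.mono (Set.Icc_subset_Icc_right hh.le)
  obtain ⟨θW, hθW, h0⟩ := intermediate_value_Ioo hl.le hHcont ⟨hneg, hpos 0 le_rfl hh⟩
  dsimp only at h0
  refine ⟨θW, hθW, h0, fun t ht => ?_, fun t ht => ?_, fun t ht => ?_⟩
  · rw [← h0]
    exact hinc t θW ht.1 ht.2 hθW.2.le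
  · rcases le_total t 0 with h | h
    · rw [← h0]
      exact hinc θW t hθW.1.le ht.1 h
    · exact hpos t h ht.2
  · rcases le_total t 0 with h | h
    · exact hinc θl t le_rfl ht.1 h
    · rcases ht.2.lt_or_eq with h' | rfl
      · exact hneg.trans (hpos t h h')
      · simpa using hneg

end Threshold

/-! ### The prior -/

section Prior

variable {θl θh : ℝ} {f : ℝ → ℝ} {μ₀ : ProbabilityMeasure (Set.Icc θl θh)}

theorem measurableSet_le_coe (t : ℝ) : MeasurableSet {θ : Set.Icc θl θh | t ≤ (θ : ℝ)} :=
  measurableSet_le measurable_const measurable_subtype_coe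

theorem setIntegral_prior (hf : ContinuousOn f (Set.Icc θl θh))
    (hfpos : ∀ θ ∈ Set.Icc θl θh, 0 < f θ)
    (hμ₀ : (μ₀ : Measure (Set.Icc θl θh)) =
      ((volume : Measure ℝ).comap Subtype.val).withDensity (fun θ => ENNReal.ofReal (f θ)))
    (g : ℝ → ℝ) {t : ℝ} (ht : t ∈ Set.Icc θl θh) :
    ∫ θ in {θ : Set.Icc θl θh | t ≤ (θ : ℝ)}, g θ ∂(μ₀ : Measure (Set.Icc θl θh)) =
      ∫ x in t..θh, g x * f x := by
  have hfc : Continuous fun θ : Set.Icc θl θh => f θ := hf.domRestrict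
  rw [← integral_indicator (measurableSet_le_coe t), hμ₀,
    integral_withDensity_eq_integral_toReal_smul hfc.measurable.ennreal_ofReal (ae_of_all _ fun θ => by simp)]
  have h1 : ∀ θ : Set.Icc θl θh, (ENNReal.ofReal (f θ)).toReal •
      {θ : Set.Icc θl θh | t ≤ (θ : ℝ)}.indicator (fun θ => g θ) θ =
        (Set.Ici t).indicator (fun x => g x * f x) (θ : ℝ) := fun θ => by
    rw [ENNReal.toReal_ofReal (hfpos θ θ.2).le]
    by_cases h : t ≤ (θ : ℝ) <;> simp [Set.indicator, h, mul_comm]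
  simp_rw [h1]
  rw [integral_subtype_comap measurableSet_Icc ((Set.Ici t).indicator fun x => g x * f x),
    setIntegral_indicator measurableSet_Ici, intervalIntegral.integral_of_le ht.2,
    ← integral_Icc_eq_integral_Ioc]
  congr 2
  ext x
  simp only [Set.mem_inter_iff, Set.mem_Icc, Set.mem_Ici]
  exact ⟨fun h => ⟨h.2, h.1.2⟩, fun h => ⟨⟨ht.1.trans h.1, h.2⟩, h.1⟩⟩

theorem measureReal_prior (hf : ContinuousOn f (Set.Icc θl θh))
    (hfpos : ∀ θ ∈ Set.Icc θl θh, 0 < f θ)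
    (hμ₀ : (μ₀ : Measure (Set.Icc θl θh)) =
      ((volume : Measure ℝ).comap Subtype.val).withDensity (fun θ => ENNReal.ofReal (f θ)))
    {t : ℝ} (ht : t ∈ Set.Icc θl θh) :
    (μ₀ : Measure (Set.Icc θl θh)).real {θ | t ≤ (θ : ℝ)} = ∫ x in t..θh, f x := by
  have h := setIntegral_prior hf hfpos hμ₀ (fun _ => 1) ht
  simpa using h

theorem measureReal_prior_lt (hf : ContinuousOn f (Set.Icc θl θh))
    (hfpos : ∀ θ ∈ Set.Icc θl θh, 0 < f θ)
    (hμ₀ : (μ₀ : Measure (Set.Icc θl θh)) =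
      ((volume : Measure ℝ).comap Subtype.val).withDensity (fun θ => ENNReal.ofReal (f θ)))
    {s t : ℝ} (hs : s ∈ Set.Icc θl θh) (ht : t ∈ Set.Icc θl θh) (hst : s < t) :
    (μ₀ : Measure (Set.Icc θl θh)).real {θ | t ≤ (θ : ℝ)} <
      (μ₀ : Measure (Set.Icc θl θh)).real {θ | s ≤ (θ : ℝ)} := by
  have hint : ∀ a ∈ Set.Icc θl θh, ∀ b ∈ Set.Icc θl θh, IntervalIntegrable f volume a b :=
    fun a ha b hb => (hf.mono (Set.uIcc_subset_Icc ha hb)).intervalIntegrable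
  have hh : θh ∈ Set.Icc θl θh := ⟨ht.1.trans ht.2, le_rfl⟩
  rw [measureReal_prior hf hfpos hμ₀ hs, measureReal_prior hf hfpos hμ₀ ht,
    ← intervalIntegral.integral_add_adjacent_intervals (hint s hs t ht) (hint t ht θh hh)]
  have := intervalIntegral.intervalIntegral_pos_of_pos_on (hint s hs t ht)
    (fun x hx => hfpos x ⟨hs.1.trans hx.1.le, hx.2.le.trans ht.2⟩) hst
  linarith

/-- The prior has no atoms, so {θ ≥ t} and {θ > t} have the same mass. -/
theorem one_sub_priorCdf
    (hμ₀ : (μ₀ : Measure (Set.Icc θl θh)) =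
      ((volume : Measure ℝ).comap Subtype.val).withDensity (fun θ => ENNReal.ofReal (f θ)))
    (t : ℝ) :
    1 - priorCdf μ₀ t = (μ₀ : Measure (Set.Icc θl θh)).real {θ | t ≤ (θ : ℝ)} := by
  have : IsProbabilityMeasure ((μ₀ : Measure (Set.Icc θl θh)).map Subtype.val) :=
    Measure.isProbabilityMeasure_map measurable_subtype_coe.aemeasurable
  have hatom : (μ₀ : Measure (Set.Icc θl θh)) (Subtype.val ⁻¹' {t}) = 0 := by
    rw [hμ₀]
    apply withDensity_absolutelyContinuous
    rw [comap_subtype_coe_apply measurableSet_Icc volume]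
    refine measure_mono_null ?_ (Real.volume_singleton (a := t))
    rintro _ ⟨θ, hθ, rfl⟩
    exact hθ
  have hset : {θ : Set.Icc θl θh | t ≤ (θ : ℝ)} =ᵐ[(μ₀ : Measure (Set.Icc θl θh))]
      ((Subtype.val ⁻¹' Set.Iic t)ᶜ : Set (Set.Icc θl θh)) := by
    have h : ∀ᵐ θ : Set.Icc θl θh ∂(μ₀ : Measure (Set.Icc θl θh)), (θ : ℝ) ≠ t := by
      rw [ae_iff]
      convert! hatom using 2
      ext θ
      simp
    filter_upwards [h] with θ hθ
    apply propext
    change t ≤ (θ : ℝ) ↔ ¬ (θ : ℝ) ≤ t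
    rw [not_le]
    exact ⟨fun h => lt_of_le_of_ne h hθ.symm, le_of_lt⟩
  rw [priorCdf, cdf_eq_real, map_measureReal_apply measurable_subtype_coe measurableSet_Iic,
    measureReal_congr hset, probReal_compl_eq_one_sub (measurable_subtype_coe measurableSet_Iic)]

end Prior

/-! ### Threshold signals -/

section ThresholdSignal

variable {θl θh : ℝ}

theorem expMoment_sub_one (ρ : ℝ) (μ : ProbabilityMeasure (Set.Icc θl θh)) :
    ∫ θ : Set.Icc θl θh, (Real.exp (ρ * (θ : ℝ)) - 1) ∂(μ : Measure (Set.Icc θl θh)) =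
      expMoment ρ μ - 1 := by
  rw [integral_sub (integrable_of_continuous (by fun_prop)) (integrable_const _)]
  simp [expMoment]

theorem measurable_threshold (t : ℝ) :
    Measurable fun θ : Set.Icc θl θh => if t ≤ (θ : ℝ) then (1 : Fin 2) else 0 :=
  Measurable.ite (measurableSet_le_coe t) measurable_const measurable_const

/-- When signal 1 has positive probability, the sign of H(t) decides whether it persuades. -/
theorem expMoment_posteriorBelief_one (ρ t : ℝ) (μ₀ : ProbabilityMeasure (Set.Icc θl θh)) :
    (μ₀ : Measure (Set.Icc θl θh)).real {θ | t ≤ (θ : ℝ)} *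
      (expMoment ρ (posteriorBelief μ₀ (thresholdSignal θl θh t) 1) - 1) =
        ∫ θ in {θ : Set.Icc θl θh | t ≤ (θ : ℝ)}, (Real.exp (ρ * (θ : ℝ)) - 1)
          ∂(μ₀ : Measure (Set.Icc θl θh)) := by
  have hset : (fun θ : Set.Icc θl θh => if t ≤ (θ : ℝ) then (1 : Fin 2) else 0) ⁻¹' {1} =
      {θ : Set.Icc θl θh | t ≤ (θ : ℝ)} := by
    ext θ
    simp
  have h := measureReal_mul_integral_posteriorBelief_deterministic μ₀
    (measurable_threshold t) (1 : Fin 2)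
    fun θ : Set.Icc θl θh => Real.exp (ρ * (θ : ℝ)) - 1
  rw [hset, expMoment_sub_one] at h
  exact h

theorem expMoment_posteriorBelief_zero (ρ t : ℝ) (μ₀ : ProbabilityMeasure (Set.Icc θl θh)) :
    (1 - (μ₀ : Measure (Set.Icc θl θh)).real {θ | t ≤ (θ : ℝ)}) *
      (expMoment ρ (posteriorBelief μ₀ (thresholdSignal θl θh t) 0) - 1) =
        (expMoment ρ μ₀ - 1) - ∫ θ in {θ : Set.Icc θl θh | t ≤ (θ : ℝ)},
          (Real.exp (ρ * (θ : ℝ)) - 1) ∂(μ₀ : Measure (Set.Icc θl θh)) := by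
  have hset : (fun θ : Set.Icc θl θh => if t ≤ (θ : ℝ) then (1 : Fin 2) else 0) ⁻¹' {0} =
      {θ : Set.Icc θl θh | t ≤ (θ : ℝ)}ᶜ := by
    ext θ
    simp
  have h := measureReal_mul_integral_posteriorBelief_deterministic μ₀
    (measurable_threshold t) (0 : Fin 2)
    fun θ : Set.Icc θl θh => Real.exp (ρ * (θ : ℝ)) - 1
  rw [hset, expMoment_sub_one, probReal_compl_eq_one_sub (measurableSet_le_coe t)] at h
  refine h.trans ?_
  rw [← expMoment_sub_one, eq_sub_iff_add_eq', integral_add_compl (measurableSet_le_coe t)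
    (integrable_of_continuous (by fun_prop))]

theorem inducedPolicy_thresholdSignal (ρ t : ℝ) (μ₀ : ProbabilityMeasure (Set.Icc θl θh)) :
    (inducedPolicy μ₀ (thresholdSignal θl θh t)).real {μ | 1 ≤ expMoment ρ μ} =
      (μ₀ : Measure (Set.Icc θl θh)).real {θ | 1 ≤ expMoment ρ
        (posteriorBelief μ₀ (thresholdSignal θl θh t) (if t ≤ (θ : ℝ) then 1 else 0))} :=
  congrArg ENNReal.toReal (inducedPolicy_deterministic μ₀
    (measurable_threshold t)
    (measurableSet_one_le_expMoment ρ))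

theorem setIntegral_thresholdSignal (t : ℝ) (μ₀ : ProbabilityMeasure (Set.Icc θl θh)) :
    ∫ θ in {θ : Set.Icc θl θh | t ≤ (θ : ℝ)}, (thresholdSignal θl θh t θ).real {1}
      ∂(μ₀ : Measure (Set.Icc θl θh)) =
        (μ₀ : Measure (Set.Icc θl θh)).real {θ | t ≤ (θ : ℝ)} := by
  have h : ∀ θ ∈ {θ : Set.Icc θl θh | t ≤ (θ : ℝ)},
      (thresholdSignal θl θh t θ).real {1} = 1 := fun θ hθ => by
    rw [thresholdSignal, Kernel.deterministic_apply, if_pos (by exact hθ), measureReal_def]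
    simp
  rw [setIntegral_congr_fun (measurableSet_le_coe t) h]
  simp

end ThresholdSignal

end Wishful

/-! ### Optimality and uniqueness of the threshold -/

theorem proposition4 (θl θh ρ v : ℝ) (hl : θl < 0) (hh : 0 < θh) (hρ : 0 < ρ) (hv : 0 < v)
    (f : ℝ → ℝ) (hf : ContinuousOn f (Set.Icc θl θh)) (hfpos : ∀ θ ∈ Set.Icc θl θh, 0 < f θ)
    (μ₀ : ProbabilityMeasure (Set.Icc θl θh))
    (hμ₀ : (μ₀ : Measure (Set.Icc θl θh)) =
      ((volume : Measure ℝ).comap Subtype.val).withDensity (fun θ => ENNReal.ofReal (f θ)))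
    (hx : ∫ θ, Real.exp (ρ * (θ : ℝ)) ∂(μ₀ : Measure (Set.Icc θl θh)) < 1) :
    ∃ θW ∈ Set.Icc θl θh,
      -- the threshold is the unique solution of the indifference equation
      (Wishful.priorCdf μ₀ θW < 1 ∧
        1 / (1 - Wishful.priorCdf μ₀ θW) * ∫ θ in θW..θh, Real.exp (ρ * θ) * f θ = 1) ∧
      (∀ t ∈ Set.Icc θl θh,
        1 / (1 - Wishful.priorCdf μ₀ t) * ∫ θ in t..θh, Real.exp (ρ * θ) * f θ = 1 → t = θW) ∧
      -- revealing whether the state is above the threshold is optimal for Sender, among all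
      -- information policies, and no other threshold does as well
      (∀ t ∈ Set.Icc θl θh,
        Wishful.IsOptimalPolicy (Wishful.investorUtility θl θh) (Wishful.brokerUtility v) ρ μ₀
          (Wishful.inducedPolicy μ₀ (Wishful.thresholdSignal θl θh t)) ↔ t = θW) ∧
      -- Receiver invests after the signal `1` and does not invest after the signal `0`
      (∀ s : Fin 2,
        Wishful.equilibriumActions (Wishful.investorUtility θl θh) (Wishful.brokerUtility v) ρ
          (Wishful.posteriorBelief μ₀ (Wishful.thresholdSignal θl θh θW) s) = {s}) ∧
      -- the probability of inducing investment
      (∫ θ in {θ : Set.Icc θl θh | θW ≤ (θ : ℝ)},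
          (Wishful.thresholdSignal θl θh θW θ).real {1} ∂(μ₀ : Measure (Set.Icc θl θh)) =
        1 - Wishful.priorCdf μ₀ θW) ∧
      (Wishful.inducedPolicy μ₀ (Wishful.thresholdSignal θl θh θW)).real
          {μ | Wishful.equilibriumActions (Wishful.investorUtility θl θh)
            (Wishful.brokerUtility v) ρ μ = {1}} =
        1 - Wishful.priorCdf μ₀ θW := by
  have hlh : θl ≤ θh := (hl.trans hh).le
  have hlmem : θl ∈ Set.Icc θl θh := Set.left_mem_Icc.mpr hlh
  have hhmem : θh ∈ Set.Icc θl θh := Set.right_mem_Icc.mpr hlh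
  set P : ℝ → ℝ := fun t => (μ₀ : Measure (Set.Icc θl θh)).real {θ | t ≤ (θ : ℝ)} with hP
  have hcdf : ∀ t, 1 - Wishful.priorCdf μ₀ t = P t := Wishful.one_sub_priorCdf hμ₀
  have hP_anti : ∀ s ∈ Set.Icc θl θh, ∀ t ∈ Set.Icc θl θh, s < t → P t < P s :=
    fun s hs t ht => Wishful.measureReal_prior_lt hf hfpos hμ₀ hs ht
  have hPl : P θl = 1 := by
    have h : {θ : Set.Icc θl θh | θl ≤ (θ : ℝ)} = Set.univ :=
      Set.eq_univ_of_forall fun θ => θ.2.1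
    simp only [hP]
    rw [h, probReal_univ]
  have hPh : P θh = 0 := by
    simp only [hP]
    rw [Wishful.measureReal_prior hf hfpos hμ₀ hhmem, intervalIntegral.integral_same]
  have hH : ∀ t ∈ Set.Icc θl θh, ∫ θ in {θ : Set.Icc θl θh | t ≤ (θ : ℝ)},
      (Real.exp (ρ * (θ : ℝ)) - 1) ∂(μ₀ : Measure (Set.Icc θl θh)) =
        ∫ x in t..θh, (Real.exp (ρ * x) - 1) * f x := fun t ht =>
    Wishful.setIntegral_prior hf hfpos hμ₀ (fun x => Real.exp (ρ * x) - 1) ht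
  have hexp : ∀ t ∈ Set.Icc θl θh, ∫ x in t..θh, Real.exp (ρ * x) * f x =
      (∫ x in t..θh, (Real.exp (ρ * x) - 1) * f x) + P t := fun t ht => by
    rw [← hH t ht, ← Wishful.setIntegral_prior hf hfpos hμ₀ (fun x => Real.exp (ρ * x)) ht,
      integral_sub (Wishful.integrable_of_continuous (by fun_prop)) (integrable_const _)]
    simp [hP]
  have hprior : Wishful.expMoment ρ μ₀ - 1 = ∫ x in θl..θh, (Real.exp (ρ * x) - 1) * f x := by
    rw [← hH θl hlmem, ← Wishful.expMoment_sub_one, ← setIntegral_univ]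
    congr 2
    exact (Set.eq_univ_of_forall fun θ => θ.2.1).symm
  obtain ⟨θW, hθW, hW0, hWneg, hWpos, hWl⟩ := Wishful.exists_threshold hl hh hρ hf hfpos
    (hprior ▸ sub_neg.mpr hx)
  have hWmem : θW ∈ Set.Icc θl θh := ⟨hθW.1.le, (hθW.2.trans hh).le⟩
  have hPW : 0 < P θW := hPh ▸ hP_anti θW hWmem θh hhmem (hθW.2.trans hh)
  have hone : ∀ t ∈ Set.Icc θl θh,
      P t * (Wishful.expMoment ρ (Wishful.posteriorBelief μ₀
        (Wishful.thresholdSignal θl θh t) 1) - 1) =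
          ∫ x in t..θh, (Real.exp (ρ * x) - 1) * f x := fun t ht => by
    rw [← hH t ht, ← Wishful.expMoment_posteriorBelief_one]
  -- The threshold θl is excluded: signal 0 is then never sent and its posterior is arbitrary.
  have hzero : ∀ t ∈ Set.Ioc θl θh, Wishful.expMoment ρ (Wishful.posteriorBelief μ₀
      (Wishful.thresholdSignal θl θh t) 0) < 1 := fun t ht => by
    have ht' := Set.Ioc_subset_Icc_self ht
    have h := Wishful.expMoment_posteriorBelief_zero ρ t μ₀
    rw [hH t ht', hprior] at h
    have h1 := hP_anti θl hlmem t ht' ht.1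
    rw [hPl] at h1
    have h2 := hWl t ht
    by_contra! h3
    have := mul_nonneg (sub_nonneg.mpr h1.le) (sub_nonneg.mpr h3)
    rw [h] at this
    linarith
  have hWone : 1 ≤ Wishful.expMoment ρ (Wishful.posteriorBelief μ₀
      (Wishful.thresholdSignal θl θh θW) 1) := by
    have h := hone θW hWmem
    rw [hW0, mul_eq_zero] at h
    rcases h with h | h <;> linarith
  have hWzero := hzero θW ⟨hθW.1, hWmem.2⟩
  have hWvalue : (Wishful.inducedPolicy μ₀ (Wishful.thresholdSignal θl θh θW)).real
      {μ | 1 ≤ Wishful.expMoment ρ μ} = P θW := by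
    rw [Wishful.inducedPolicy_thresholdSignal]
    congr 1
    ext θ
    by_cases h : θW ≤ (θ : ℝ)
    · simp [h, hWone]
    · simp [h, hWzero]
  have hvalue_lt : ∀ t ∈ Set.Icc θl θh, t ≠ θW →
      (Wishful.inducedPolicy μ₀ (Wishful.thresholdSignal θl θh t)).real
        {μ | 1 ≤ Wishful.expMoment ρ μ} < P θW := fun t ht hne => by
    rw [Wishful.inducedPolicy_thresholdSignal]
    -- Only signal 1 can persuade. If t = θl, no state lies below t, so `hzero` is needed only for t
    -- > θl.
    have hsub : ∀ θ : Set.Icc θl θh, 1 ≤ Wishful.expMoment ρ (Wishful.posteriorBelief μ₀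
        (Wishful.thresholdSignal θl θh t) (if t ≤ (θ : ℝ) then 1 else 0)) → t ≤ (θ : ℝ) :=
      fun θ h => by
        by_contra h'
        rw [if_neg h'] at h
        exact (hzero t ⟨θ.2.1.trans_lt (not_le.mp h'), ht.2⟩).not_ge h
    rcases hne.lt_or_gt with hlt | hgt
    -- Below θW, H(t) < 0, so signal 1 fails to persuade as well and the investment probability is 0
    -- < P θW.
    · have h1 : Wishful.expMoment ρ (Wishful.posteriorBelief μ₀
          (Wishful.thresholdSignal θl θh t) 1) < 1 := by
        by_contra! h
        have h2 := mul_nonneg (measureReal_nonneg : 0 ≤ P t) (sub_nonneg.mpr h)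
        rw [hone t ht] at h2
        exact (hWneg t ⟨ht.1, hlt⟩).not_ge h2
      convert! hPW
      refine (congrArg _ (Set.eq_empty_of_forall_notMem fun θ hθ => ?_)).trans measureReal_empty
      have h2 : 1 ≤ Wishful.expMoment ρ (Wishful.posteriorBelief μ₀
        (Wishful.thresholdSignal θl θh t) (if t ≤ (θ : ℝ) then 1 else 0)) := hθ
      rw [if_pos (hsub θ hθ)] at h2
      exact h1.not_ge h2
    · exact (measureReal_mono hsub).trans_lt (hP_anti θW hWmem t ht hgt)
  refine ⟨θW, hWmem, ⟨?_, ?_⟩, fun t ht h => ?_, fun t ht => ⟨fun h => ?_, ?_⟩, fun s => ?_, ?_, ?_⟩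
  · linarith [hcdf θW]
  · rw [hcdf, hexp θW hWmem, hW0, zero_add, one_div_mul_cancel hPW.ne']
  · rw [hcdf, hexp t ht] at h
    -- This rules out t = θh, the other zero of H: there 1 / 0 = 0 makes the left side of the
    -- equation 0 instead of 1.
    have hPt : P t ≠ 0 := by
      intro h0
      simp [h0] at h
    have hzt : ∫ x in t..θh, (Real.exp (ρ * x) - 1) * f x = 0 := by
      field_simp at h
      linarith
    have hth : t < θh := lt_of_le_of_ne ht.2 fun h => hPt (h ▸ hPh)
    rcases lt_trichotomy t θW with hlt | heq | hgt
    · exact absurd hzt (hWneg t ⟨ht.1, hlt⟩).ne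
    · exact heq
    · exact absurd hzt (hWpos t ⟨hgt, hth⟩).ne'
  · by_contra hne
    have h1 := h.2 _ (Wishful.inducedPolicy_mem_bayesPlausible μ₀
      (Wishful.thresholdSignal θl θh θW))
    rw [Wishful.policyValue_investor hρ hv, Wishful.policyValue_investor hρ hv, hWvalue] at h1
    exact (mul_lt_mul_of_pos_right (hvalue_lt t ht hne) hv).not_ge h1
  · rintro rfl
    refine ⟨Wishful.inducedPolicy_mem_bayesPlausible μ₀ _, fun τ hτ => ?_⟩
    rw [Wishful.policyValue_investor hρ hv, Wishful.policyValue_investor hρ hv, hWvalue]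
    exact mul_le_mul_of_nonneg_right (Wishful.measureReal_one_le_expMoment_le hρ hθW.2
      ((hH t ht).trans hW0) hτ) hv.le
  · fin_cases s
    · exact Wishful.equilibriumActions_of_lt_one hρ hWzero
    · exact Wishful.equilibriumActions_of_one_le hρ hv hWone
  · rw [hcdf, Wishful.setIntegral_thresholdSignal]
  · simp_rw [Wishful.equilibriumActions_eq_singleton_one_iff hρ hv]
    rw [hWvalue, hcdf]
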